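/- Let $N$ be a finitely generated free abelian group, $N_{\mathbb R}=\mathbb R\otimes_{\mathbb Z}N$ and $M=\operatorname{Hom}(N,\mathbb Z)$, with pairing $\langle m,v\rangle$ extended $\mathbb R$-linearly to $v\in N_{\mathbb R}$. Let $\Sigma$ be a unimodular fan in $N_{\mathbb R}$, i.e. a finite collection of strongly convex rational polyhedral cones, closed under taking faces, any two of which intersect in a common face, such that each cone is generated by part of a $\mathbb Z$-basis of $N$. Let $|\Sigma|$ be the union of the cones, $\Sigma(1)$ the set of rays (one-dimensional cones), and $u_\rho\in N$ the primitive generator of $\rho\in\Sigma(1)$. Let $\mathrm L(\Sigma)$ be the group of functions $|\Sigma|\to\mathbb R$ that are restrictions of elements of $M$, and $\mathrm{PL}(\Sigma)$ the group of functions $f:|\Sigma|\to\mathbb R$ such that for every $\sigma\in\Sigma$ there is $m_\sigma\in M$ with $f|_\sigma=m_\sigma|_\sigma$. Let $\mathrm{PE}(\Sigma)$ be the ring of functions $|\Sigma|\to\mathbb R$ of the form $\sum_{i=1}^n a_ie^{f_i}$ with $n\in\mathbb N$, $a_i\in\mathbb Z$, $f_i\in\mathrm{PL}(\Sigma)$,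 and set \[\underline{\mathrm{PE}}(\Sigma)=\mathrm{PE}(\Sigma)\big/\langle e^\ell-1\mid \ell\in\mathrm L(\Sigma)\rangle .\] For $\rho\in\Sigma(1)$ let $\delta_\rho\in\mathrm{PL}(\Sigma)$ be the unique element taking the value $1$ at $u_\rho$ and vanishing on all other rays of $\Sigma$. Then the $\mathbb Z$-algebra homomorphism \[\phi:\mathbb Z[x_\rho\mid\rho\in\Sigma(1)]\to\underline{\mathrm{PE}}(\Sigma),\qquad \phi(x_\rho)=1-[e^{\delta_\rho}],\] is surjective with kernel $\mathcal I+\mathcal J$, where \[\mathcal I=\langle x_{\rho_1}\cdots x_{\rho_k}\mid \rho_1,\dots,\rho_k\text{ do not lie on a common cone of }\Sigma\rangle,\] \[\mathcal J=\Big\langle\prod_{\rho:\,\langle m,u_\rho\rangle>0}(1-x_\rho)^{\langle m,u_\rho\rangle}-\prod_{\rho:\,\langle m,u_\rho\rangle<0}(1-x_\rho)^{-\langle m,u_\rho\rangle}\;\Big|\;m\in M\Big\rangle .\] Consequently $\phi$ induces an isomorphism of $\mathbb Z$-algebras \[\mathbb Z[x_\rho\mid\rho\in\Sigma(1)]/(\mathcal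 I+\mathcal J)\;\cong\;\underline{\mathrm{PE}}(\Sigma).\] -/

import Mathlib

open scoped TensorProduct

noncomputable section

namespace ToricFan

/-! ### The lattice, its real vector space and its dual -/

/-- The real vector space `N_ℝ = ℝ ⊗_ℤ N`. -/
abbrev RealSpace (N : Type*) [AddCommGroup N] : Type _ := ℝ ⊗[ℤ] N

/-- The canonical map `N → N_ℝ`. -/
def latticePt {N : Type*} [AddCommGroup N] (v : N) : RealSpace N := (1 : ℝ) ⊗ₜ[ℤ] v

/-- The pairing `⟨m, -⟩ : N_ℝ → ℝ` with `m ∈ M = Hom(N, ℤ)`, the `ℝ`-linear extension of `m`. -/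
def pairing {N : Type*} [AddCommGroup N] (m : Module.Dual ℤ N) : RealSpace N →ₗ[ℝ] ℝ :=
  (TensorProduct.AlgebraTensorModule.rid ℤ ℝ ℝ).toLinearMap ∘ₗ LinearMap.baseChange ℝ m

/-! ### Fans -/

/-- A (rational, polyhedral) fan in `N_ℝ`: a finite collection of strongly convex rational
polyhedral cones, closed under taking faces, in which any two cones meet along a common face. -/
structure Fan (N : Type*) [AddCommGroup N] where
  /-- the cones of the fan -/
  cones : Set (PointedCone ℝ (RealSpace N))
  finite_cones : cones.Finite
  rational : ∀ σ ∈ cones, ∃ G : Set N, G.Finite ∧ σ = PointedCone.hull ℝ (latticePt '' G)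
  salient : ∀ σ ∈ cones, (PointedCone.toConvexCone σ).Salient
  face_mem : ∀ σ ∈ cones, ∀ τ : PointedCone ℝ (RealSpace N), τ.IsFaceOf σ → τ ∈ cones
  inter_face : ∀ σ ∈ cones, ∀ τ ∈ cones, (σ ⊓ τ).IsFaceOf σ ∧ (σ ⊓ τ).IsFaceOf τ

/-- A unimodular fan: every cone is generated by part of a `ℤ`-basis of `N`. -/
structure UnimodularFan (N : Type*) [AddCommGroup N] extends Fan N where
  unimodular : ∀ σ ∈ cones, ∃ (b : Module.Basis (Fin (Module.finrank ℤ N)) ℤ N)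
    (s : Set (Fin (Module.finrank ℤ N))), σ = PointedCone.hull ℝ (latticePt '' (b '' s))

/-- The dimension of a cone. -/
def coneDim {N : Type*} [AddCommGroup N] (σ : PointedCone ℝ (RealSpace N)) : ℕ :=
  Module.finrank ℝ (Submodule.span ℝ (σ : Set (RealSpace N)))

/-- `u` is the primitive generator of `ρ`: the lattice points of `ρ` are exactly the
nonnegative integer multiples of `u`. -/
def IsPrimitiveGenerator {N : Type*} [AddCommGroup N] (ρ : PointedCone ℝ (RealSpace N))
    (u : N) : Prop :=
  ∀ v : N, latticePt v ∈ ρ ↔ ∃ k : ℕ, v = k • u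

/-! ### Auxiliary facts on the pairing and on unimodular cones -/

section Aux

variable {N : Type*} [AddCommGroup N]

lemma pairing_latticePt (m : Module.Dual ℤ N) (v : N) : pairing m (latticePt v) = m v := by
  simp [pairing, latticePt]

lemma pairing_zero : pairing (0 : Module.Dual ℤ N) = 0 := by
  simp [pairing]

lemma pairing_add (m m' : Module.Dual ℤ N) : pairing (m + m') = pairing m + pairing m' := by
  simp [pairing, LinearMap.baseChange_add, LinearMap.comp_add]

lemma pairing_neg (m : Module.Dual ℤ N) : pairing (-m) = -pairing m := by
  simp [pairing, LinearMap.baseChange_neg, LinearMap.comp_neg]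

lemma latticePt_mem_hull {ι : Type*} (b : Module.Basis ι ℤ N) {s : Set ι} {i : ι} (hi : i ∈ s) :
    latticePt (b i) ∈ PointedCone.hull ℝ (latticePt '' (b '' s)) :=
  Submodule.subset_span ⟨_, ⟨i, hi, rfl⟩, rfl⟩

variable {ι : Type*} [Fintype ι] (b : Module.Basis ι ℤ N)

lemma sum_pairing_coord (x : RealSpace N) :
    ∑ i, pairing (b.coord i) x • latticePt (b i) = x := by
  classical
  induction x using TensorProduct.induction_on with
  | zero => simp
  | add x y hx hy => simp only [map_add, add_smul, Finset.sum_add_distrib, hx, hy]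
  | tmul r v =>
    have h : ∀ i, pairing (b.coord i) (r ⊗ₜ[ℤ] v) • latticePt (b i) =
        r ⊗ₜ[ℤ] (b.repr v i • b i) := by
      intro i
      simp only [pairing, latticePt, LinearMap.comp_apply, LinearMap.baseChange_tmul,
        LinearEquiv.coe_coe, TensorProduct.AlgebraTensorModule.rid_tmul, Module.Basis.coord_apply,
        TensorProduct.smul_tmul', TensorProduct.tmul_smul]
      simp
    simp only [h, ← TensorProduct.tmul_sum, b.sum_repr]

lemma mem_hull_iff (s : Set ι) (x : RealSpace N) :
    x ∈ PointedCone.hull ℝ (latticePt '' (b '' s)) ↔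
      (∀ i, 0 ≤ pairing (b.coord i) x) ∧ ∀ i, i ∉ s → pairing (b.coord i) x = 0 := by
  classical
  constructor
  · intro hx
    induction hx using Submodule.span_induction with
    | mem x h =>
      obtain ⟨_, ⟨j, hj, rfl⟩, rfl⟩ := h
      simp only [pairing_latticePt, Module.Basis.coord_apply, Module.Basis.repr_self,
        Finsupp.single_apply]
      refine ⟨fun i => by split_ifs <;> simp, fun i hi => ?_⟩
      rw [if_neg (by rintro rfl; exact hi hj)]; simp
    | zero => simp
    | add x y _ _ hx hy =>
      simp only [map_add]
      exact ⟨fun i => add_nonneg (hx.1 i) (hy.1 i), fun i hi => by rw [hx.2 i hi, hy.2 i hi, add_zero]⟩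
    | smul a x _ hx =>
      have h : ∀ i, pairing (b.coord i) (a • x) = (a : ℝ) * pairing (b.coord i) x := by
        intro i
        exact (pairing (b.coord i)).map_smul (a : ℝ) x
      simp only [h]
      exact ⟨fun i => mul_nonneg a.2 (hx.1 i), fun i hi => by rw [hx.2 i hi, mul_zero]⟩
  · rintro ⟨h0, hs⟩
    rw [← sum_pairing_coord b x]
    refine Submodule.sum_mem _ fun i _ => ?_
    by_cases hi : i ∈ s
    · exact Submodule.smul_mem _ (⟨_, h0 i⟩ : {c : ℝ // 0 ≤ c})
        (Submodule.subset_span ⟨_, ⟨i, hi, rfl⟩, rfl⟩)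
    · rw [hs i hi, zero_smul]; exact Submodule.zero_mem _

lemma hull_isFaceOf {s t : Set ι} (hts : t ⊆ s) :
    (PointedCone.hull ℝ (latticePt '' (b '' t))).IsFaceOf
      (PointedCone.hull ℝ (latticePt '' (b '' s))) := by
  refine ⟨Submodule.span_mono (Set.image_mono (Set.image_mono hts)), ?_⟩
  intro x y a hx hy ha hxy
  rw [mem_hull_iff] at hx hy hxy ⊢
  refine ⟨hx.1, fun i hi => ?_⟩
  have h1 := hxy.2 i hi
  rw [map_add, map_smul, smul_eq_mul] at h1
  have h2 := hx.1 i
  have h3 := hy.1 i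
  nlinarith [mul_nonneg ha.le h2, mul_pos_iff_of_pos_left (b := pairing (b.coord i) x) ha]

lemma coneDim_hull (s : Set ι) :
    coneDim (PointedCone.hull ℝ (latticePt '' (b '' s))) = s.ncard := by
  classical
  have hspan : Submodule.span ℝ
      ((PointedCone.hull ℝ (latticePt '' (b '' s)) : PointedCone ℝ (RealSpace N)) :
        Set (RealSpace N)) = Submodule.span ℝ (latticePt '' (b '' s)) :=
    le_antisymm (Submodule.span_le.2 (PointedCone.hull_le_span ℝ _))
      (Submodule.span_mono Submodule.subset_span)
  have hli : LinearIndependent ℝ (fun i : ι => latticePt (b i)) := by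
    have h := (b.baseChange ℝ).linearIndependent
    have h2 : (⇑(b.baseChange ℝ) : ι → RealSpace N) = fun i => latticePt (b i) := by
      ext i; simp [latticePt]
    rwa [h2] at h
  have himg : latticePt '' (b '' s) = Set.range (fun i : s => latticePt (b i)) := by
    rw [Set.image_image, Set.image_eq_range]
  rw [coneDim, hspan, himg]
  have := finrank_span_eq_card (hli.comp ((↑) : s → ι) Subtype.val_injective)
  rw [← Nat.card_coe_set_eq, Nat.card_eq_fintype_card]
  exact this

lemma isPrimitiveGenerator_hull (i : ι) :
    IsPrimitiveGenerator (PointedCone.hull ℝ (latticePt '' (b '' {i}))) (b i) := by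
  classical
  intro v
  rw [mem_hull_iff]
  simp only [pairing_latticePt, Int.cast_nonneg_iff, Int.cast_eq_zero, Set.mem_singleton_iff]
  constructor
  · rintro ⟨h0, h1⟩
    refine ⟨(b.coord i v).toNat, ?_⟩
    rw [← natCast_zsmul, Int.toNat_of_nonneg (h0 i)]
    conv_lhs => rw [← b.sum_repr v]
    refine Finset.sum_eq_single i (fun j _ hj => ?_) (by simp)
    have := h1 j hj
    rw [Module.Basis.coord_apply] at this
    rw [this, zero_smul]
  · rintro ⟨k, rfl⟩
    simp only [map_nsmul, Module.Basis.coord_apply, Module.Basis.repr_self, Finsupp.single_apply]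
    refine ⟨fun j => by split_ifs <;> simp, fun j hj => ?_⟩
    rw [if_neg (fun h => hj h.symm)]; simp

lemma IsPrimitiveGenerator.mem {ρ : PointedCone ℝ (RealSpace N)} {u : N}
    (h : IsPrimitiveGenerator ρ u) : latticePt u ∈ ρ :=
  (h u).2 ⟨1, (one_smul _ _).symm⟩

lemma IsPrimitiveGenerator.unique [Module.Free ℤ N] {ρ : PointedCone ℝ (RealSpace N)} {u u' : N}
    (h : IsPrimitiveGenerator ρ u) (h' : IsPrimitiveGenerator ρ u') : u = u' := by
  obtain ⟨k, hk⟩ := (h' u).1 h.mem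
  obtain ⟨l, hl⟩ := (h u').1 h'.mem
  by_cases hu : u = 0
  · rw [hl, hu, smul_zero]
  have h1 : ((k : ℤ) * l) • u = (1 : ℤ) • u := by
    rw [one_smul, mul_smul, natCast_zsmul, natCast_zsmul, ← hl, ← hk]
  have h2 : (k : ℤ) * l = 1 := smul_left_injective ℤ hu h1
  have h3 : k = 1 := Nat.eq_one_of_mul_eq_one_right (by exact_mod_cast h2)
  rw [hk, h3, one_smul]

end Aux

namespace Fan

variable {N : Type*} [AddCommGroup N] (F : Fan N)

/-- The set `Σ(1)` of rays (one-dimensional cones) of the fan, as a type. -/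
def Ray : Type _ := {ρ : PointedCone ℝ (RealSpace N) // ρ ∈ F.cones ∧ coneDim ρ = 1}

instance : Finite F.Ray := (F.finite_cones.subset (fun _ h => h.1) :
  {ρ | ρ ∈ F.cones ∧ coneDim ρ = 1}.Finite).to_subtype

instance : Fintype F.Ray := Fintype.ofFinite _

/-- The support `|Σ|`, the union of all cones. -/
def support : Set (RealSpace N) := {x | ∃ σ ∈ F.cones, x ∈ σ}

/-- The group `L(Σ)` of integral linear functions on `|Σ|`. -/
def L : AddSubgroup (F.support → ℝ) where
  carrier := {f | ∃ m : Module.Dual ℤ N, ∀ x : F.support, f x = pairing m x}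
  zero_mem' := ⟨0, fun x => by simp [pairing_zero]⟩
  add_mem' := by
    rintro f g ⟨m, hm⟩ ⟨m', hm'⟩
    exact ⟨m + m', fun x => by simp [pairing_add, hm, hm']⟩
  neg_mem' := by
    rintro f ⟨m, hm⟩
    exact ⟨-m, fun x => by simp [pairing_neg, hm]⟩

/-- The group `PL(Σ)` of integral piecewise-linear functions on `|Σ|`. -/
def PL : AddSubgroup (F.support → ℝ) where
  carrier := {f | ∀ σ ∈ F.cones, ∃ m : Module.Dual ℤ N,
    ∀ x : F.support, (x : RealSpace N) ∈ σ → f x = pairing m x}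
  zero_mem' := fun σ _ => ⟨0, fun x _ => by simp [pairing_zero]⟩
  add_mem' := by
    intro f g hf hg σ hσ
    obtain ⟨m, hm⟩ := hf σ hσ
    obtain ⟨m', hm'⟩ := hg σ hσ
    exact ⟨m + m', fun x hx => by simp [pairing_add, hm x hx, hm' x hx]⟩
  neg_mem' := by
    intro f hf σ hσ
    obtain ⟨m, hm⟩ := hf σ hσ
    exact ⟨-m, fun x hx => by simp [pairing_neg, hm x hx]⟩

/-- `G` is integral piecewise-exponential: `G = ∑ a_i e^{f_i}`, a finite sum with `a_i ∈ ℤ` and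
`f_i ∈ PL(Σ)`. -/
def IsPiecewiseExp (G : F.support → ℝ) : Prop :=
  ∃ (n : ℕ) (a : Fin n → ℤ) (f : Fin n → F.PL),
    ∀ x, G x = ∑ i, (a i : ℝ) * Real.exp ((f i : F.support → ℝ) x)

lemma isPiecewiseExp_of_fintype {ι : Type*} [Fintype ι] (a : ι → ℤ) (f : ι → F.PL)
    (G : F.support → ℝ) (h : ∀ x, G x = ∑ i, (a i : ℝ) * Real.exp ((f i : F.support → ℝ) x)) :
    F.IsPiecewiseExp G := by
  refine ⟨Fintype.card ι, a ∘ (Fintype.equivFin ι).symm, f ∘ (Fintype.equivFin ι).symm,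
    fun x => ?_⟩
  rw [h x]
  exact (Equiv.sum_comp (Fintype.equivFin ι).symm
    (fun i => (a i : ℝ) * Real.exp ((f i : F.support → ℝ) x))).symm

/-- The ring `PE(Σ)` of integral piecewise-exponential functions on `|Σ|`, with pointwise
operations. -/
def PE : Subring (F.support → ℝ) where
  carrier := {G | F.IsPiecewiseExp G}
  zero_mem' := F.isPiecewiseExp_of_fintype (ι := Fin 0) (fun _ => 0) (fun _ => 0) _ (by simp)
  one_mem' := F.isPiecewiseExp_of_fintype (ι := Unit) (fun _ => 1) (fun _ => 0) _ (by simp)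
  add_mem' := by
    rintro G H ⟨n, a, f, h⟩ ⟨n', a', f', h'⟩
    exact F.isPiecewiseExp_of_fintype (Sum.elim a a') (Sum.elim f f') _
      (fun x => by simp [h, h'])
  mul_mem' := by
    rintro G H ⟨n, a, f, h⟩ ⟨n', a', f', h'⟩
    refine F.isPiecewiseExp_of_fintype (fun p : Fin n × Fin n' => a p.1 * a' p.2)
      (fun p => f p.1 + f' p.2) _ (fun x => ?_)
    rw [Pi.mul_apply, h, h', Finset.sum_mul_sum, Fintype.sum_prod_type]
    refine Finset.sum_congr rfl fun i _ => Finset.sum_congr rfl fun j _ => ?_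
    simp only [AddSubgroup.coe_add, Pi.add_apply, Real.exp_add, Int.cast_mul]
    ring
  neg_mem' := by
    rintro G ⟨n, a, f, h⟩
    exact F.isPiecewiseExp_of_fintype (fun i => -a i) f _ (fun x => by simp [h])

/-- The exponential `e^f ∈ PE(Σ)` of `f ∈ PL(Σ)`. -/
def expPL (f : F.PL) : F.PE :=
  ⟨fun x => Real.exp ((f : F.support → ℝ) x),
    F.isPiecewiseExp_of_fintype (ι := Unit) (fun _ => 1) (fun _ => f) _ (by simp)⟩

lemma L_le_PL : F.L ≤ F.PL := by
  rintro f ⟨m, hm⟩ σ _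
  exact ⟨m, fun x _ => hm x⟩

/-- The ideal `⟨e^ℓ - 1 | ℓ ∈ L(Σ)⟩` of `PE(Σ)`. -/
def linearIdeal : Ideal F.PE :=
  Ideal.span (Set.range fun l : F.L => F.expPL ⟨l, F.L_le_PL l.2⟩ - 1)

/-- The quotient ring of `PE(Σ)` by `⟨e^ℓ - 1 | ℓ ∈ L(Σ)⟩`. -/
abbrev PEbar : Type _ := F.PE ⧸ F.linearIdeal

/-- The Stanley–Reisner ideal, generated by the products of rays that do not lie on a common
cone of the fan. -/
def idealI : Ideal (MvPolynomial F.Ray ℤ) :=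
  Ideal.span {p | ∃ T : Finset F.Ray, (¬ ∃ σ ∈ F.cones, ∀ ρ ∈ T, ρ.1 ≤ σ) ∧
    p = ∏ ρ ∈ T, MvPolynomial.X ρ}

end Fan

namespace UnimodularFan

variable {N : Type*} [AddCommGroup N] (F : UnimodularFan N)

lemma exists_isPrimitiveGenerator (ρ : F.Ray) : ∃ u : N, IsPrimitiveGenerator ρ.1 u := by
  obtain ⟨b, s, h⟩ := F.unimodular ρ.1 ρ.2.1
  have hd := ρ.2.2
  rw [h, coneDim_hull, Set.ncard_eq_one] at hd
  obtain ⟨i, rfl⟩ := hd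
  exact ⟨b i, h ▸ isPrimitiveGenerator_hull b i⟩

/-- The primitive generator `u_ρ ∈ N` of the ray `ρ`. -/
def gen (ρ : F.Ray) : N := (F.exists_isPrimitiveGenerator ρ).choose

lemma gen_spec (ρ : F.Ray) : IsPrimitiveGenerator ρ.1 (F.gen ρ) :=
  (F.exists_isPrimitiveGenerator ρ).choose_spec

/-- The primitive generator `u_ρ`, as a point of `|Σ|`. -/
def genPt (ρ : F.Ray) : F.support :=
  ⟨latticePt (F.gen ρ), ρ.1, ρ.2.1, (F.gen_spec ρ).mem⟩

/-- `f` is the Courant function of `ρ`: it takes the value `1` at `u_ρ` and vanishes along all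
other rays. -/
def IsCourant (ρ : F.Ray) (f : F.PL) : Prop :=
  (f : F.support → ℝ) (F.genPt ρ) = 1 ∧
    ∀ ρ' : F.Ray, ρ' ≠ ρ → ∀ x : F.support, (x : RealSpace N) ∈ ρ'.1 →
      (f : F.support → ℝ) x = 0

section Courant

variable [Module.Free ℤ N]

lemma ray_eq_hull (ρ : F.Ray) :
    ρ.1 = PointedCone.hull ℝ {latticePt (F.gen ρ)} := by
  obtain ⟨b, s, h⟩ := F.unimodular ρ.1 ρ.2.1
  have hd := ρ.2.2
  rw [h, coneDim_hull, Set.ncard_eq_one] at hd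
  obtain ⟨i, rfl⟩ := hd
  have := (F.gen_spec ρ).unique (h ▸ isPrimitiveGenerator_hull b i)
  rw [this, h, Set.image_singleton, Set.image_singleton]

lemma gen_injective : Function.Injective F.gen := by
  intro ρ ρ' h
  apply Subtype.ext
  rw [F.ray_eq_hull ρ, F.ray_eq_hull ρ', h]

variable {F} in
lemma exists_ray {σ : PointedCone ℝ (RealSpace N)} (hσ : σ ∈ F.cones)
    (b : Module.Basis (Fin (Module.finrank ℤ N)) ℤ N) (s : Set (Fin (Module.finrank ℤ N)))
    (h : σ = PointedCone.hull ℝ (latticePt '' (b '' s))) {i : Fin (Module.finrank ℤ N)}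
    (hi : i ∈ s) : ∃ ρ : F.Ray, F.gen ρ = b i := by
  have hmem := F.face_mem σ hσ _ (h ▸ hull_isFaceOf b (Set.singleton_subset_iff.2 hi))
  refine ⟨⟨_, hmem, by rw [coneDim_hull, Set.ncard_singleton]⟩, ?_⟩
  exact (F.gen_spec _).unique (isPrimitiveGenerator_hull b i)

lemma ray_le_of_mem (ρ : F.Ray) {τ : PointedCone ℝ (RealSpace N)}
    (h : latticePt (F.gen ρ) ∈ τ) : ρ.1 ≤ τ := by
  rw [F.ray_eq_hull ρ]
  exact Submodule.span_le.2 (Set.singleton_subset_iff.2 h)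

variable {F} in
lemma gen_mem_of_le {σ : PointedCone ℝ (RealSpace N)} (hσ : σ ∈ F.cones)
    (b : Module.Basis (Fin (Module.finrank ℤ N)) ℤ N) (s : Set (Fin (Module.finrank ℤ N)))
    (h : σ = PointedCone.hull ℝ (latticePt '' (b '' s))) (ρ : F.Ray) (hρ : ρ.1 ≤ σ) :
    ∃ i ∈ s, F.gen ρ = b i := by
  classical
  have hface : ρ.1.IsFaceOf σ := by
    have := (F.inter_face σ hσ ρ.1 ρ.2.1).1
    rwa [inf_eq_right.2 hρ] at this
  have hu : latticePt (F.gen ρ) ∈ ρ.1 := (F.gen_spec ρ).mem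
  have huσ := hρ hu
  rw [h, mem_hull_iff] at huσ
  have hne : ∃ i, pairing (b.coord i) (latticePt (F.gen ρ)) ≠ 0 := by
    by_contra! hall
    have h0 : latticePt (F.gen ρ) = 0 := by
      rw [← sum_pairing_coord b (latticePt (F.gen ρ))]
      simp [hall]
    have hd := ρ.2.2
    have hz : PointedCone.hull ℝ {(0 : RealSpace N)} = ⊥ := Submodule.span_zero_singleton _
    rw [F.ray_eq_hull ρ, h0, hz, coneDim] at hd
    have hs : Submodule.span ℝ
        (((⊥ : PointedCone ℝ (RealSpace N)) : Set (RealSpace N))) = ⊥ := by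
      rw [Submodule.span_eq_bot]
      intro x hx
      exact hx
    rw [hs, finrank_bot] at hd
    exact zero_ne_one hd
  obtain ⟨i, hi⟩ := hne
  have his : i ∈ s := by
    by_contra hn
    exact hi (huσ.2 i hn)
  have hpos : 0 < pairing (b.coord i) (latticePt (F.gen ρ)) := lt_of_le_of_ne (huσ.1 i) hi.symm
  refine ⟨i, his, ?_⟩
  have hbi : latticePt (b i) ∈ ρ.1 := by
    have hsum := sum_pairing_coord b (latticePt (F.gen ρ))
    rw [← Finset.add_sum_erase _ _ (Finset.mem_univ i)] at hsum
    refine hface.mem_of_smul_add_mem (a := pairing (b.coord i) (latticePt (F.gen ρ)))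
      (y := ∑ j ∈ Finset.univ.erase i,
        pairing (b.coord j) (latticePt (F.gen ρ)) • latticePt (b j)) ?_ ?_ hpos ?_
    · rw [h]; exact latticePt_mem_hull b his
    · rw [h]
      refine Submodule.sum_mem _ fun j _ => ?_
      by_cases hj : j ∈ s
      · exact Submodule.smul_mem _ (⟨_, huσ.1 j⟩ : {c : ℝ // 0 ≤ c}) (latticePt_mem_hull b hj)
      · rw [huσ.2 j hj, zero_smul]; exact Submodule.zero_mem _
    · rw [hsum]; exact hu
  obtain ⟨k, hk⟩ := (F.gen_spec ρ (b i)).1 hbi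
  have h1 : (k : ℤ) * b.coord i (F.gen ρ) = 1 := by
    have := congrArg (b.coord i) hk
    rw [map_nsmul, Module.Basis.coord_apply, Module.Basis.repr_self, Finsupp.single_eq_same,
      nsmul_eq_mul] at this
    exact_mod_cast this.symm
  have hk1 : k = 1 := by
    have := Int.isUnit_iff.1 (IsUnit.of_mul_eq_one _ h1)
    omega
  rw [hk, hk1, one_smul]

variable {F} in
/-- Two linear functions that agree on the generators of the common rays of two cones agree on
their intersection. -/
lemma pairing_eq_of_gen {σ τ : PointedCone ℝ (RealSpace N)} (hσ : σ ∈ F.cones)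
    (hτ : τ ∈ F.cones) (m m' : Module.Dual ℤ N)
    (hm : ∀ ρ : F.Ray, ρ.1 ≤ σ → ρ.1 ≤ τ → m (F.gen ρ) = m' (F.gen ρ))
    {x : RealSpace N} (hxσ : x ∈ σ) (hxτ : x ∈ τ) : pairing m x = pairing m' x := by
  classical
  obtain ⟨b, s, h⟩ := F.unimodular σ hσ
  have hx := hxσ
  rw [h, mem_hull_iff] at hx
  have hsum := sum_pairing_coord b x
  rw [← hsum, map_sum, map_sum]
  refine Finset.sum_congr rfl fun i _ => ?_
  rw [map_smul, map_smul, pairing_latticePt, pairing_latticePt]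
  by_cases h0 : pairing (b.coord i) x = 0
  · rw [h0, zero_smul, zero_smul]
  have his : i ∈ s := by
    by_contra hn
    exact h0 (hx.2 i hn)
  obtain ⟨ρ, hρ⟩ := exists_ray hσ b s h his
  have hbσ : latticePt (b i) ∈ σ := by rw [h]; exact latticePt_mem_hull b his
  have hb : latticePt (b i) ∈ σ ⊓ τ := by
    rw [← Finset.add_sum_erase _ _ (Finset.mem_univ i)] at hsum
    refine (F.inter_face σ hσ τ hτ).1.mem_of_smul_add_mem (a := pairing (b.coord i) x)
      (y := ∑ j ∈ Finset.univ.erase i, pairing (b.coord j) x • latticePt (b j)) hbσ ?_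
      (lt_of_le_of_ne (hx.1 i) (Ne.symm h0)) ?_
    · rw [h]
      refine Submodule.sum_mem _ fun j _ => ?_
      by_cases hj : j ∈ s
      · exact Submodule.smul_mem _ (⟨_, hx.1 j⟩ : {c : ℝ // 0 ≤ c}) (latticePt_mem_hull b hj)
      · rw [hx.2 j hj, zero_smul]; exact Submodule.zero_mem _
    · rw [hsum]; exact ⟨hxσ, hxτ⟩
  rw [← hρ] at hb ⊢
  rw [hm ρ (F.ray_le_of_mem ρ hb.1) (F.ray_le_of_mem ρ hb.2)]

open Classical in
lemma exists_local_courant (ρ : F.Ray) {σ : PointedCone ℝ (RealSpace N)} (hσ : σ ∈ F.cones) :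
    ∃ m : Module.Dual ℤ N, ∀ ρ' : F.Ray, ρ'.1 ≤ σ → m (F.gen ρ') = if ρ' = ρ then 1 else 0 := by
  obtain ⟨b, s, h⟩ := F.unimodular σ hσ
  by_cases hρ : ρ.1 ≤ σ
  · obtain ⟨i, _, hgi⟩ := gen_mem_of_le hσ b s h ρ hρ
    refine ⟨b.coord i, fun ρ' hρ' => ?_⟩
    obtain ⟨j, _, hgj⟩ := gen_mem_of_le hσ b s h ρ' hρ'
    rw [hgj, Module.Basis.coord_apply, Module.Basis.repr_self, Finsupp.single_apply]
    refine if_congr ?_ rfl rfl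
    rw [← F.gen_injective.eq_iff, hgi, hgj, b.injective.eq_iff]
  · refine ⟨0, fun ρ' hρ' => ?_⟩
    rw [if_neg (by rintro rfl; exact hρ hρ')]
    rfl

/-- There is exactly one Courant function for each ray. -/
lemma existsUnique_isCourant (ρ : F.Ray) : ∃! f : F.PL, F.IsCourant ρ f := by
  classical
  choose! m hm using fun σ (hσ : σ ∈ F.cones) => F.exists_local_courant ρ hσ
  choose c hc hxc using fun x : F.support => x.2
  have key : ∀ (x : F.support), ∀ σ ∈ F.cones, (x : RealSpace N) ∈ σ →
      pairing (m (c x)) x = pairing (m σ) x := fun x σ hσ hx =>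
    pairing_eq_of_gen (hc x) hσ _ _
      (fun ρ' h1 h2 => (hm _ (hc x) ρ' h1).trans (hm σ hσ ρ' h2).symm) (hxc x) hx
  refine ⟨⟨fun x => pairing (m (c x)) x, fun σ hσ => ⟨m σ, fun x hx => key x σ hσ hx⟩⟩,
    ⟨?_, ?_⟩, ?_⟩
  · change pairing (m (c (F.genPt ρ))) (F.genPt ρ) = 1
    rw [key (F.genPt ρ) ρ.1 ρ.2.1 (F.gen_spec ρ).mem]
    change pairing (m ρ.1) (latticePt (F.gen ρ)) = 1
    rw [pairing_latticePt, hm ρ.1 ρ.2.1 ρ le_rfl, if_pos rfl, Int.cast_one]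
  · intro ρ' hne x hx
    change pairing (m (c x)) x = 0
    rw [key x ρ'.1 ρ'.2.1 hx]
    rw [F.ray_eq_hull ρ', PointedCone.hull, Submodule.mem_span_singleton] at hx
    obtain ⟨a, ha⟩ := hx
    rw [← ha]
    have h1 : pairing (m ρ'.1) (a • latticePt (F.gen ρ')) =
        (a : ℝ) * pairing (m ρ'.1) (latticePt (F.gen ρ')) :=
      (pairing (m ρ'.1)).map_smul (a : ℝ) _
    rw [h1, pairing_latticePt, hm ρ'.1 ρ'.2.1 ρ' le_rfl, if_neg hne, Int.cast_zero, mul_zero]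
  · rintro ⟨f, hf⟩ ⟨h1, h2⟩
    refine Subtype.ext (funext fun x => ?_)
    change f x = pairing (m (c x)) x
    obtain ⟨l, hl⟩ := hf (c x) (hc x)
    rw [hl x (hxc x)]
    refine pairing_eq_of_gen (hc x) (hc x) _ _ (fun ρ' hρ' _ => ?_) (hxc x) (hxc x)
    rw [hm _ (hc x) ρ' hρ']
    have h3 := hl (F.genPt ρ') (hρ' (F.gen_spec ρ').mem)
    have h4 : f (F.genPt ρ') = l (F.gen ρ') := h3.trans (pairing_latticePt l (F.gen ρ'))
    split_ifs with hr
    · subst hr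
      have h5 : f (F.genPt ρ') = 1 := h1
      rw [h5] at h4
      exact_mod_cast h4.symm
    · have h5 : f (F.genPt ρ') = 0 := h2 ρ' hr _ (F.gen_spec ρ').mem
      rw [h5] at h4
      exact_mod_cast h4.symm

/-- The Courant function `δ_ρ ∈ PL(Σ)`. -/
def courant (ρ : F.Ray) : F.PL := (F.existsUnique_isCourant ρ).choose

lemma courant_spec (ρ : F.Ray) : F.IsCourant ρ (F.courant ρ) :=
  (F.existsUnique_isCourant ρ).choose_spec.1

/-- The `ℤ`-algebra homomorphism `φ` on `ℤ[x_ρ]` with `φ(x_ρ) = 1 - [e^{δ_ρ}]`. -/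
def phi : MvPolynomial F.Ray ℤ →ₐ[ℤ] F.PEbar :=
  MvPolynomial.aeval fun ρ => 1 - Ideal.Quotient.mk F.linearIdeal (F.expPL (F.courant ρ))

end Courant

/-- The ideal `J` generated, for `m ∈ M`, by the differences of
`∏_{⟨m,u_ρ⟩ > 0} (1 - x_ρ)^{⟨m,u_ρ⟩}` and `∏_{⟨m,u_ρ⟩ < 0} (1 - x_ρ)^{-⟨m,u_ρ⟩}`. -/
def idealJ : Ideal (MvPolynomial F.Ray ℤ) :=
  Ideal.span (Set.range fun m : Module.Dual ℤ N =>
    (∏ ρ : F.Ray with 0 < m (F.gen ρ), (1 - MvPolynomial.X ρ) ^ (m (F.gen ρ)).toNat) -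
      ∏ ρ : F.Ray with m (F.gen ρ) < 0, (1 - MvPolynomial.X ρ) ^ (-m (F.gen ρ)).toNat)

end UnimodularFan

end ToricFan

end

open scoped TensorProduct

noncomputable section

namespace ToricFan

namespace Fan

variable {N : Type*} [AddCommGroup N] (F : Fan N)

/-! Before dividing by linear functions, `phiPE` sends $1-x_\rho$ to $e^{\delta_\rho}$. Its kernel
is exactly $\mathcal I$ (`ker_phiPE`): on a cone the Courant functions of its rays are independent
coordinates with values in $[0,\infty)$, so a polynomial in the corresponding $1-e^{\delta_\rho}$
vanishes on the cone only if it is zero.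

The map `phiPE` need not be surjective, since $f=\sum n_\rho\delta_\rho$ may have negative $n_\rho$,
but every element of $\mathrm{PE}(\Sigma)$ enters the image after multiplication by a product of the
$e^{\delta_\rho}$ (`exists_mul_eq_phiPE`). In the same way $e^\ell-1$ becomes the image of a
generator of $\mathcal J$.

The decisive point is that these denominators are already invertible modulo $\mathcal I+\mathcal J$
(`map_X_ne_one`, `isUnit_mk_of_mem`). At a point of the quotient with values in a domain, $\mathcal
I$ forces the nonvanishing $x_\rho$ onto one cone. If some $x_\rho=1$, unimodularity gives $m$ dual
to $u_\rho$ on that cone, and its relation in $\mathcal J$ reads $0=1$. Clearing denominators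
therefore gives both surjectivity and the kernel. -/

lemma expPL_apply (f : F.PL) (x : F.support) :
    (F.expPL f : F.support → ℝ) x = Real.exp ((f : F.support → ℝ) x) := rfl

lemma expPL_zero : F.expPL 0 = 1 :=
  Subtype.ext (funext fun _ => Real.exp_zero)

lemma expPL_add (f g : F.PL) : F.expPL (f + g) = F.expPL f * F.expPL g :=
  Subtype.ext (funext fun _ => Real.exp_add _ _)

lemma expPL_nsmul (n : ℕ) (f : F.PL) : F.expPL (n • f) = F.expPL f ^ n := by
  induction n with
  | zero => rw [zero_nsmul, expPL_zero, pow_zero]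
  | succ n ih => rw [succ_nsmul, expPL_add, ih, pow_succ]

lemma expPL_sum {ι : Type*} (s : Finset ι) (f : ι → F.PL) :
    F.expPL (∑ i ∈ s, f i) = ∏ i ∈ s, F.expPL (f i) := by
  classical
  induction s using Finset.induction_on with
  | empty => simp [expPL_zero]
  | insert a s ha ih => rw [Finset.sum_insert ha, Finset.prod_insert ha, expPL_add, ih]

lemma exists_eq_sum_expPL (G : F.PE) :
    ∃ (n : ℕ) (a : Fin n → ℤ) (f : Fin n → F.PL), G = ∑ i, (a i : F.PE) * F.expPL (f i) := by
  obtain ⟨n, a, f, h⟩ := G.2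
  refine ⟨n, a, f, Subtype.ext (funext fun x => ?_)⟩
  rw [h x]
  simp [expPL_apply]

/-- The integral linear function on `|Σ|` defined by `m ∈ M`. -/
def linearFun (m : Module.Dual ℤ N) : F.L := ⟨fun x => pairing m x, m, fun _ => rfl⟩

/-- The multiplicative monoid generated by the polynomials `1 - x_ρ`. -/
def oneSubXMonoid : Submonoid (MvPolynomial F.Ray ℤ) :=
  Submonoid.closure (Set.range fun ρ => 1 - MvPolynomial.X ρ)

variable {F} in
lemma oneSubX_mem (ρ : F.Ray) : 1 - MvPolynomial.X ρ ∈ F.oneSubXMonoid :=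
  Submonoid.subset_closure ⟨ρ, rfl⟩

end Fan

namespace UnimodularFan

variable {N : Type*} [AddCommGroup N] (F : UnimodularFan N)

/-! ### Piecewise-linear functions in Courant coordinates -/

lemma PL_value_int (f : F.PL) (ρ : F.Ray) :
    ∃ n : ℤ, (f : F.support → ℝ) (F.genPt ρ) = n := by
  obtain ⟨m, hm⟩ := f.2 ρ.1 ρ.2.1
  exact ⟨m (F.gen ρ), (hm _ (F.gen_spec ρ).mem).trans (pairing_latticePt m _)⟩

/-- The product `∏ (1 - x_ρ)^{n_ρ⁺}`. -/
def posProd (n : F.Ray → ℤ) : MvPolynomial F.Ray ℤ :=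
  ∏ ρ : F.Ray with 0 < n ρ, (1 - MvPolynomial.X ρ) ^ (n ρ).toNat

/-- The product `∏ (1 - x_ρ)^{n_ρ⁻}`. -/
def negProd (n : F.Ray → ℤ) : MvPolynomial F.Ray ℤ :=
  ∏ ρ : F.Ray with n ρ < 0, (1 - MvPolynomial.X ρ) ^ (-n ρ).toNat

lemma negProd_mem (n : F.Ray → ℤ) : F.negProd n ∈ F.oneSubXMonoid :=
  Submonoid.prod_mem _ fun ρ _ => Submonoid.pow_mem _ (Fan.oneSubX_mem ρ) _

lemma linearFun_genPt (m : Module.Dual ℤ N) (ρ : F.Ray) :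
    (F.linearFun m : F.support → ℝ) (F.genPt ρ) = m (F.gen ρ) :=
  pairing_latticePt m (F.gen ρ)

lemma posProd_sub_negProd_mem (m : Module.Dual ℤ N) :
    F.posProd (fun ρ => m (F.gen ρ)) - F.negProd (fun ρ => m (F.gen ρ)) ∈ F.idealJ :=
  Ideal.subset_span ⟨m, rfl⟩

variable [Module.Free ℤ N]

variable {F} in
/-- Two piecewise-linear functions that agree on the generators of the rays of a cone agree on
the cone. -/
lemma PL_eq_on_cone {σ : PointedCone ℝ (RealSpace N)} (hσ : σ ∈ F.cones) (f g : F.PL)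
    (h : ∀ ρ : F.Ray, ρ.1 ≤ σ →
      (f : F.support → ℝ) (F.genPt ρ) = (g : F.support → ℝ) (F.genPt ρ))
    {x : F.support} (hx : (x : RealSpace N) ∈ σ) :
    (f : F.support → ℝ) x = (g : F.support → ℝ) x := by
  obtain ⟨m, hm⟩ := f.2 σ hσ
  obtain ⟨m', hm'⟩ := g.2 σ hσ
  rw [hm x hx, hm' x hx]
  refine pairing_eq_of_gen hσ hσ _ _ (fun ρ hρ _ => ?_) hx hx
  have h1 := h ρ hρ
  rw [hm _ (hρ (F.gen_spec ρ).mem), hm' _ (hρ (F.gen_spec ρ).mem)] at h1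
  change pairing m (latticePt (F.gen ρ)) = pairing m' (latticePt (F.gen ρ)) at h1
  rw [pairing_latticePt, pairing_latticePt] at h1
  exact_mod_cast h1

variable {F} in
lemma PL_ext {f g : F.PL}
    (h : ∀ ρ : F.Ray, (f : F.support → ℝ) (F.genPt ρ) = (g : F.support → ℝ) (F.genPt ρ)) :
    f = g := by
  refine Subtype.ext (funext fun x => ?_)
  obtain ⟨σ, hσ, hx⟩ := x.2
  exact PL_eq_on_cone hσ f g (fun ρ _ => h ρ) hx

open Classical in
lemma courant_genPt (ρ ρ' : F.Ray) :
    (F.courant ρ : F.support → ℝ) (F.genPt ρ') = if ρ' = ρ then 1 else 0 := by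
  split_ifs with h
  · rw [h]; exact (F.courant_spec ρ).1
  · exact (F.courant_spec ρ).2 ρ' h _ (F.gen_spec ρ').mem

lemma courant_eq_zero {σ : PointedCone ℝ (RealSpace N)} (hσ : σ ∈ F.cones) {ρ : F.Ray}
    (hρ : ¬ ρ.1 ≤ σ) {x : F.support} (hx : (x : RealSpace N) ∈ σ) :
    (F.courant ρ : F.support → ℝ) x = 0 := by
  refine PL_eq_on_cone hσ (F.courant ρ) 0 (fun ρ' hρ' => ?_) hx
  rw [courant_genPt, if_neg (by rintro rfl; exact hρ hρ')]
  rfl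

lemma sum_smul_courant_genPt (n : F.Ray → ℤ) (ρ : F.Ray) :
    ((∑ ρ', n ρ' • F.courant ρ' : F.PL) : F.support → ℝ) (F.genPt ρ) = n ρ := by
  classical
  rw [AddSubgroup.val_finsetSum, Finset.sum_apply]
  simp [courant_genPt]

/-- The Courant functions form a $\mathbb Z$-basis of $\mathrm{PL}(\Sigma)$, dual to evaluation at
the $u_\rho$. -/
lemma PL_eq_sum_courant (f : F.PL) (n : F.Ray → ℤ)
    (hn : ∀ ρ, (f : F.support → ℝ) (F.genPt ρ) = n ρ) : f = ∑ ρ, n ρ • F.courant ρ :=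
  PL_ext fun ρ => by rw [hn, sum_smul_courant_genPt]

/-! ### The map to $\mathrm{PE}(\Sigma)$ and the Stanley–Reisner ideal -/

/-- The `ℤ`-algebra homomorphism `ℤ[x_ρ] → PE(Σ)` with `x_ρ ↦ 1 - e^{δ_ρ}`. -/
def phiPE : MvPolynomial F.Ray ℤ →ₐ[ℤ] F.PE :=
  MvPolynomial.aeval fun ρ => 1 - F.expPL (F.courant ρ)

lemma phi_eq (p : MvPolynomial F.Ray ℤ) :
    F.phi p = Ideal.Quotient.mk F.linearIdeal (F.phiPE p) := by
  have : F.phi = (Ideal.Quotient.mkₐ ℤ F.linearIdeal).comp F.phiPE := by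
    ext ρ
    simp [phi, phiPE]
  rw [this]; rfl

lemma phiPE_oneSubX (ρ : F.Ray) :
    F.phiPE (1 - MvPolynomial.X ρ) = F.expPL (F.courant ρ) := by
  simp [phiPE]

/-- The value of the image of `p` in `PE(Σ)` at a point `x` of the support. -/
lemma phiPE_apply (p : MvPolynomial F.Ray ℤ) (x : F.support) :
    (F.phiPE p : F.support → ℝ) x =
      MvPolynomial.aeval (fun ρ => 1 - Real.exp ((F.courant ρ : F.support → ℝ) x)) p := by
  have : ((Pi.evalRingHom (fun _ : F.support => ℝ) x).comp F.PE.subtype).comp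
      (F.phiPE : MvPolynomial F.Ray ℤ →+* F.PE) =
      (MvPolynomial.aeval (fun ρ => 1 - Real.exp ((F.courant ρ : F.support → ℝ) x)) :
        MvPolynomial F.Ray ℤ →ₐ[ℤ] ℝ).toRingHom := by
    refine MvPolynomial.ringHom_ext (fun n => by simp) fun ρ => ?_
    simp [phiPE, Fan.expPL_apply]
  exact congrArg (fun φ => φ p) this

/-- Every point lies in some cone $\sigma$. One of the rays in the product is not in $\sigma$, and
its Courant function vanishes there, so its factor is $1-e^0=0$. -/
lemma idealI_le_ker_phiPE : F.idealI ≤ RingHom.ker F.phiPE := by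
  refine Ideal.span_le.2 ?_
  rintro _ ⟨T, hT, rfl⟩
  refine (RingHom.mem_ker).2 (Subtype.ext (funext fun x => ?_))
  rw [phiPE_apply]
  obtain ⟨σ, hσ, hx⟩ := x.2
  obtain ⟨ρ, hρT, hρ⟩ : ∃ ρ ∈ T, ¬ ρ.1 ≤ σ := by
    by_contra! h
    exact hT ⟨σ, hσ, h⟩
  rw [map_prod]
  refine Finset.prod_eq_zero hρT ?_
  rw [MvPolynomial.aeval_X, F.courant_eq_zero hσ hρ hx, Real.exp_zero, sub_self]

/-- A cone contains a point with arbitrary prescribed nonnegative coordinates along its rays. -/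
lemma exists_courant_eq {σ : PointedCone ℝ (RealSpace N)} (hσ : σ ∈ F.cones) (t : F.Ray → ℝ)
    (ht : ∀ ρ, 0 ≤ t ρ) (ht0 : ∀ ρ : F.Ray, ¬ ρ.1 ≤ σ → t ρ = 0) :
    ∃ x : F.support, ∀ ρ, (F.courant ρ : F.support → ℝ) x = t ρ := by
  classical
  have hx : ∑ ρ, t ρ • latticePt (F.gen ρ) ∈ σ := by
    refine Submodule.sum_mem _ fun ρ _ => ?_
    by_cases hρ : ρ.1 ≤ σ
    · exact Submodule.smul_mem _ (⟨_, ht ρ⟩ : {c : ℝ // 0 ≤ c}) (hρ (F.gen_spec ρ).mem)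
    · rw [ht0 ρ hρ, zero_smul]; exact Submodule.zero_mem _
  refine ⟨⟨_, σ, hσ, hx⟩, fun ρ => ?_⟩
  obtain ⟨m, hm⟩ := (F.courant ρ).2 σ hσ
  rw [hm _ hx, map_sum, Finset.sum_eq_single ρ]
  · by_cases hρ : ρ.1 ≤ σ
    · have h1 := hm (F.genPt ρ) (hρ (F.gen_spec ρ).mem)
      rw [courant_genPt, if_pos rfl] at h1
      change 1 = pairing m (latticePt (F.gen ρ)) at h1
      rw [map_smul, ← h1, smul_eq_mul, mul_one]
    · rw [ht0 ρ hρ, zero_smul, map_zero]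
  · intro ρ' _ hne
    by_cases hρ : ρ'.1 ≤ σ
    · have h1 := hm (F.genPt ρ') (hρ (F.gen_spec ρ').mem)
      rw [courant_genPt, if_neg hne] at h1
      change 0 = pairing m (latticePt (F.gen ρ')) at h1
      rw [map_smul, ← h1, smul_zero]
    · rw [ht0 ρ' hρ, zero_smul, map_zero]
  · simp

/-- The kernel of the map to `PE(Σ)` is the Stanley–Reisner ideal. -/
lemma ker_phiPE : RingHom.ker F.phiPE = F.idealI := by
  classical
  refine le_antisymm (fun p hp => ?_) F.idealI_le_ker_phiPE
  rw [p.as_sum]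
  refine Ideal.sum_mem _ fun d hd => ?_
  -- It suffices that no monomial occurring in $p$ is supported on a cone. If one is supported on
  -- $\sigma$, restrict to $\sigma$, that is, set the variables of all rays outside $\sigma$ to
  -- zero.
  have hdT : ¬ ∃ σ ∈ F.cones, ∀ ρ ∈ d.support, ρ.1 ≤ σ := by
    rintro ⟨σ, hσ, hdσ⟩
    let q : MvPolynomial F.Ray ℝ := MvPolynomial.aeval
      (fun ρ : F.Ray => if ρ.1 ≤ σ then MvPolynomial.X ρ else 0) p
    have hq : q = 0 := by
      -- For $t\ge 0$ the value $1-e^t$ runs through all of $(-\infty,0]$, which is infinite. A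
      -- point with $\delta_\rho=\log(1-z_\rho)$ realises a given $z$.
      refine MvPolynomial.funext_set (fun _ => Set.Iic (0 : ℝ)) (fun _ => Set.Iic_infinite 0) ?_
      intro z hz
      obtain ⟨x, hx⟩ := F.exists_courant_eq hσ
        (fun ρ => if ρ.1 ≤ σ then Real.log (1 - z ρ) else 0)
        (fun ρ => by
          have hz' : z ρ ≤ 0 := hz ρ (Set.mem_univ _)
          split_ifs
          · exact Real.log_nonneg (by linarith)
          · exact le_rfl)
        (fun ρ hρ => if_neg hρ)
      have h0 : (F.phiPE p : F.support → ℝ) x = 0 := by rw [(RingHom.mem_ker).1 hp]; rfl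
      rw [phiPE_apply] at h0
      rw [map_zero, ← h0]
      have hcomp : ((MvPolynomial.aeval z : MvPolynomial F.Ray ℝ →ₐ[ℝ] ℝ).restrictScalars ℤ).comp
          (MvPolynomial.aeval
            (fun ρ : F.Ray => if ρ.1 ≤ σ then (MvPolynomial.X ρ : MvPolynomial F.Ray ℝ) else 0)) =
          MvPolynomial.aeval fun ρ => 1 - Real.exp ((F.courant ρ : F.support → ℝ) x) := by
        refine MvPolynomial.algHom_ext fun ρ => ?_
        have hz' : z ρ ≤ 0 := hz ρ (Set.mem_univ _)
        simp only [AlgHom.comp_apply, MvPolynomial.aeval_X, hx]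
        split_ifs
        · simp [Real.exp_log (show 0 < 1 - z ρ by linarith)]
        · simp
      exact congrArg (fun φ => φ p) hcomp
    -- The substitution keeps monomials supported on $\sigma$ and kills the others, so the
    -- coefficient at $d$ survives.
    have hcoeff : MvPolynomial.coeff d q = ((MvPolynomial.coeff d p : ℤ) : ℝ) := by
      have hqs : q = ∑ e ∈ p.support, MvPolynomial.C ((p.coeff e : ℤ) : ℝ) *
          e.prod fun ρ k => (if ρ.1 ≤ σ then (MvPolynomial.X ρ : MvPolynomial F.Ray ℝ) else 0) ^ k := by
        simp only [q]
        rw [MvPolynomial.aeval_def, MvPolynomial.eval₂_eq']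
        refine Finset.sum_congr rfl fun e _ => ?_
        rw [Finsupp.prod_fintype _ _ (fun _ => pow_zero _)]
        simp
      have hmon : ∀ e : F.Ray →₀ ℕ, (e.prod fun ρ k =>
          (if ρ.1 ≤ σ then (MvPolynomial.X ρ : MvPolynomial F.Ray ℝ) else 0) ^ k) =
          if ∀ ρ ∈ e.support, ρ.1 ≤ σ then MvPolynomial.monomial e 1 else 0 := by
        intro e
        split_ifs with he
        · rw [MvPolynomial.monomial_eq, MvPolynomial.C_1, one_mul]
          exact Finset.prod_congr rfl fun ρ hρ => by simp only [if_pos (he ρ hρ)]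
        · push Not at he
          obtain ⟨ρ, hρ, hρσ⟩ := he
          refine Finset.prod_eq_zero hρ ?_
          simp only [if_neg hρσ]
          exact zero_pow (Finsupp.mem_support_iff.1 hρ)
      rw [hqs, MvPolynomial.coeff_sum, Finset.sum_eq_single d]
      · rw [hmon, if_pos hdσ, MvPolynomial.coeff_C_mul, MvPolynomial.coeff_monomial, if_pos rfl,
          mul_one]
      · intro e _ hne
        rw [hmon, MvPolynomial.coeff_C_mul]
        split_ifs
        · rw [MvPolynomial.coeff_monomial, if_neg hne, mul_zero]
        · rw [MvPolynomial.coeff_zero, mul_zero]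
      · exact fun h => absurd hd h
    rw [hq, MvPolynomial.coeff_zero] at hcoeff
    exact MvPolynomial.mem_support_iff.1 hd (by exact_mod_cast hcoeff.symm)
  rw [MvPolynomial.monomial_eq]
  -- The monomial is divisible by the squarefree monomial with the same support, a generator of
  -- $\mathcal I$.
  refine Ideal.mul_mem_left _ _ (Ideal.mem_of_dvd _ ?_ (Ideal.subset_span ⟨d.support, hdT, rfl⟩))
  exact Finset.prod_dvd_prod_of_dvd _ _ fun ρ hρ =>
    dvd_pow_self _ (Finsupp.mem_support_iff.1 hρ)

/-! ### Exponentials with denominators and the relations in $\mathcal J$ -/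

/-- This is $e^f=\prod(e^{\delta_\rho})^{n_\rho}$ with the negative exponents moved to the other
side, via $n=n^+-n^-$. -/
lemma negProd_mul_expPL (f : F.PL) (n : F.Ray → ℤ)
    (hn : ∀ ρ, (f : F.support → ℝ) (F.genPt ρ) = n ρ) :
    F.phiPE (F.negProd n) * F.expPL f = F.phiPE (F.posProd n) := by
  have hpos : F.phiPE (F.posProd n) = F.expPL (∑ ρ, (n ρ).toNat • F.courant ρ) := by
    rw [posProd, map_prod, Fan.expPL_sum, Finset.prod_filter]
    refine Finset.prod_congr rfl fun ρ _ => ?_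
    rw [map_pow, phiPE_oneSubX, Fan.expPL_nsmul]
    split_ifs with h
    · rfl
    · rw [Int.toNat_of_nonpos (not_lt.1 h), pow_zero]
  have hneg : F.phiPE (F.negProd n) = F.expPL (∑ ρ, (-n ρ).toNat • F.courant ρ) := by
    rw [negProd, map_prod, Fan.expPL_sum, Finset.prod_filter]
    refine Finset.prod_congr rfl fun ρ _ => ?_
    rw [map_pow, phiPE_oneSubX, Fan.expPL_nsmul]
    split_ifs with h
    · rfl
    · rw [Int.toNat_of_nonpos (by omega), pow_zero]
  rw [hpos, hneg, ← Fan.expPL_add, F.PL_eq_sum_courant f n hn, ← Finset.sum_add_distrib]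
  congr 1
  refine Finset.sum_congr rfl fun ρ _ => ?_
  rw [← natCast_zsmul, ← natCast_zsmul, ← add_zsmul]
  congr 1
  omega

/-- A generator of $\mathcal J$ is $e^m-1$ up to a unit of $\mathrm{PE}(\Sigma)$, which links
$\mathcal J$ to `linearIdeal` in both directions. -/
lemma phiPE_posProd_sub_negProd (m : Module.Dual ℤ N) :
    F.phiPE (F.posProd (fun ρ => m (F.gen ρ)) - F.negProd (fun ρ => m (F.gen ρ))) =
      F.phiPE (F.negProd fun ρ => m (F.gen ρ)) *
        (F.expPL ⟨F.linearFun m, F.L_le_PL (F.linearFun m).2⟩ - 1) := by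
  rw [mul_sub, mul_one, map_sub, F.negProd_mul_expPL _ _ (F.linearFun_genPt m)]

lemma sup_le_ker_phi : F.idealI ⊔ F.idealJ ≤ RingHom.ker F.phi := by
  refine sup_le (fun p hp => ?_) (Ideal.span_le.2 ?_)
  · rw [← ker_phiPE, RingHom.mem_ker] at hp
    rw [RingHom.mem_ker, phi_eq, hp, map_zero]
  · rintro _ ⟨m, rfl⟩
    refine (RingHom.mem_ker).2 ?_
    rw [phi_eq, Ideal.Quotient.eq_zero_iff_mem]
    change F.phiPE (F.posProd (fun ρ => m (F.gen ρ)) - F.negProd (fun ρ => m (F.gen ρ))) ∈ _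
    rw [phiPE_posProd_sub_negProd]
    exact Ideal.mul_mem_left _ _ (Ideal.subset_span ⟨F.linearFun m, rfl⟩)

/-! ### Invertibility of $1-x_\rho$ modulo $\mathcal I+\mathcal J$ -/

/-- Modulo any prime containing `I + J`, the variables `x_ρ` are different from `1`. -/
lemma map_X_ne_one {k : Type*} [CommRing k] [IsDomain k] (h : MvPolynomial F.Ray ℤ →+* k)
    (hI : F.idealI ≤ RingHom.ker h) (hJ : F.idealJ ≤ RingHom.ker h) (ρ : F.Ray) :
    h (MvPolynomial.X ρ) ≠ 1 := by
  classical
  intro hρ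
  -- In a domain a product of nonzero values is nonzero, so by $\mathcal I$ the rays with nonzero
  -- $x_{\rho'}$ share a cone. It contains $\rho$, where the value is $1$.
  obtain ⟨σ, hσ, hT⟩ : ∃ σ ∈ F.cones,
      ∀ ρ' ∈ Finset.univ.filter (fun ρ' : F.Ray => h (MvPolynomial.X ρ') ≠ 0), ρ'.1 ≤ σ := by
    by_contra hno
    have h0 := hI (Ideal.subset_span ⟨_, hno, rfl⟩)
    rw [RingHom.mem_ker, map_prod, Finset.prod_eq_zero_iff] at h0
    obtain ⟨ρ', hρ', h0⟩ := h0
    exact (Finset.mem_filter.1 hρ').2 h0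
  have hle : ρ.1 ≤ σ := hT ρ (by simp [hρ])
  obtain ⟨m, hm⟩ := F.exists_local_courant ρ hσ
  have hmρ : m (F.gen ρ) = 1 := by rw [hm ρ hle, if_pos rfl]
  have h0 := hJ (F.posProd_sub_negProd_mem m)
  have hpos : h (F.posProd fun ρ => m (F.gen ρ)) = 0 := by
    rw [posProd, map_prod]
    refine Finset.prod_eq_zero (i := ρ) (by simp [hmρ]) ?_
    simp [hmρ, hρ]
  -- On the rays of $\sigma$ the form $m$ takes only the values $0$ and $1$. A ray with $m<0$ is
  -- thus outside $\sigma$, its variable maps to $0$, and its factor is $1$.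
  have hneg : h (F.negProd fun ρ => m (F.gen ρ)) = 1 := by
    rw [negProd, map_prod]
    refine Finset.prod_eq_one fun ρ' hρ' => ?_
    have hlt := (Finset.mem_filter.1 hρ').2
    have hX : h (MvPolynomial.X ρ') = 0 := by
      by_contra hne
      have := hm ρ' (hT ρ' (by simp [hne]))
      split_ifs at this <;> omega
    simp [hX]
  rw [RingHom.mem_ker, map_sub, hpos, hneg, zero_sub, neg_eq_zero] at h0
  exact one_ne_zero h0

/-- A nonunit $1-x_\rho$ would lie in a maximal ideal, so $x_\rho$ would become $1$ in the domain
obtained as quotient. -/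
lemma isUnit_mk_of_mem {Y : MvPolynomial F.Ray ℤ} (hY : Y ∈ F.oneSubXMonoid) :
    IsUnit (Ideal.Quotient.mk (F.idealI ⊔ F.idealJ) Y) := by
  induction hY using Submonoid.closure_induction with
  | one => rw [map_one]; exact isUnit_one
  | mul x y _ _ hx hy => rw [map_mul]; exact hx.mul hy
  | mem x hx =>
    obtain ⟨ρ, rfl⟩ := hx
    by_contra hnu
    obtain ⟨P, hP, hmem⟩ := exists_max_ideal_of_mem_nonunits hnu
    have hle : F.idealI ⊔ F.idealJ ≤ P.comap (Ideal.Quotient.mk (F.idealI ⊔ F.idealJ)) := by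
      intro p hp
      rw [Ideal.mem_comap, Ideal.Quotient.eq_zero_iff_mem.2 hp]
      exact P.zero_mem
    have : P.IsPrime := hP.isPrime
    refine F.map_X_ne_one (Ideal.Quotient.mk (P.comap (Ideal.Quotient.mk (F.idealI ⊔ F.idealJ))))
      (by rw [Ideal.mk_ker]; exact le_sup_left.trans hle)
      (by rw [Ideal.mk_ker]; exact le_sup_right.trans hle) ρ ?_
    have h1 := Ideal.Quotient.eq_zero_iff_mem.2 (Ideal.mem_comap.2 hmem)
    rw [map_sub, map_one, sub_eq_zero] at h1
    exact h1.symm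

/-! ### Clearing denominators -/

/-- The map to `PE(Σ)` becomes surjective after inverting the polynomials `1 - x_ρ`. -/
lemma exists_mul_eq_phiPE (G : F.PE) :
    ∃ Y ∈ F.oneSubXMonoid, ∃ q, F.phiPE Y * G = F.phiPE q := by
  obtain ⟨n, a, f, rfl⟩ := F.exists_eq_sum_expPL G
  induction n with
  | zero => exact ⟨1, Submonoid.one_mem _, 0, by simp⟩
  | succ n ih =>
    obtain ⟨Y, hY, q, hq⟩ := ih (fun i => a i.succ) (fun i => f i.succ)
    choose k hk using F.PL_value_int (f 0)
    -- The common denominator is the one for the tail of the sum times the one for $e^{f_0}$.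
    refine ⟨Y * F.negProd k, Submonoid.mul_mem _ hY (F.negProd_mem k),
      Y * (MvPolynomial.C (a 0) * F.posProd k) + F.negProd k * q, ?_⟩
    have hC : F.phiPE (MvPolynomial.C (a 0)) = (a 0 : F.PE) := by simp
    rw [Fin.sum_univ_succ, map_add, map_mul, map_mul, map_mul, map_mul, hC, ← hq,
      ← F.negProd_mul_expPL _ _ hk, mul_add]
    ring_nf

/-- Generators are handled by `phiPE_posProd_sub_negProd`; a multiplier from $\mathrm{PE}(\Sigma)$
needs its own denominator, so denominators multiply. -/
lemma exists_mul_eq_phiPE_of_mem {G : F.PE} (hG : G ∈ F.linearIdeal) :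
    ∃ Y ∈ F.oneSubXMonoid, ∃ q ∈ F.idealJ, F.phiPE Y * G = F.phiPE q := by
  induction hG using Submodule.span_induction with
  | mem x hx =>
    obtain ⟨⟨_, m, hm⟩, rfl⟩ := hx
    refine ⟨F.negProd fun ρ => m (F.gen ρ), F.negProd_mem _, _, F.posProd_sub_negProd_mem m, ?_⟩
    rw [phiPE_posProd_sub_negProd]
    congr
    exact funext hm
  | zero => exact ⟨1, Submonoid.one_mem _, 0, Ideal.zero_mem _, by simp⟩
  | add x y _ _ hx hy =>
    obtain ⟨Y, hY, q, hq, h⟩ := hx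
    obtain ⟨Z, hZ, r, hr, h'⟩ := hy
    refine ⟨Y * Z, Submonoid.mul_mem _ hY hZ, Z * q + Y * r,
      Ideal.add_mem _ (Ideal.mul_mem_left _ _ hq) (Ideal.mul_mem_left _ _ hr), ?_⟩
    rw [map_add, map_mul, map_mul, map_mul, ← h, ← h', mul_add]
    ring_nf
  | smul a x _ hx =>
    obtain ⟨Y, hY, q, hq, h⟩ := hx
    obtain ⟨Z, hZ, r, h'⟩ := F.exists_mul_eq_phiPE a
    refine ⟨Y * Z, Submonoid.mul_mem _ hY hZ, r * q, Ideal.mul_mem_left _ _ hq, ?_⟩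
    rw [map_mul, map_mul, ← h, ← h', smul_eq_mul]
    ring_nf

/-! ### Surjectivity and kernel of $\phi$ -/

lemma phi_surjective : Function.Surjective F.phi := by
  intro y
  obtain ⟨G, rfl⟩ := Ideal.Quotient.mk_surjective y
  obtain ⟨Y, hY, q, hq⟩ := F.exists_mul_eq_phiPE G
  obtain ⟨z, hz⟩ := (F.isUnit_mk_of_mem hY).exists_right_inv
  obtain ⟨z, rfl⟩ := Ideal.Quotient.mk_surjective z
  rw [← map_mul, ← map_one (Ideal.Quotient.mk (F.idealI ⊔ F.idealJ)), Ideal.Quotient.eq] at hz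
  have h1 := F.sup_le_ker_phi hz
  rw [RingHom.mem_ker, map_sub, map_one, map_mul, sub_eq_zero] at h1
  -- Here $z$ inverts the denominator $Y$ modulo $\mathcal I+\mathcal J$, hence after applying
  -- $\phi$, so $zq$ represents $q/Y$.
  refine ⟨z * q, ?_⟩
  rw [map_mul, F.phi_eq q, ← hq, map_mul, ← phi_eq, ← mul_assoc, mul_comm (F.phi z), h1, one_mul]

/-- For $p$ in the kernel, some denominator $Y$ and $q\in\mathcal J$ satisfy $Yp-q\in\ker$ `phiPE`
$=\mathcal I$. Hence $Yp\in\mathcal I+\mathcal J$, and $Y$ cancels as a unit modulo that ideal. -/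
lemma ker_phi : RingHom.ker F.phi = F.idealI ⊔ F.idealJ := by
  refine le_antisymm (fun p hp => ?_) F.sup_le_ker_phi
  rw [RingHom.mem_ker, phi_eq, Ideal.Quotient.eq_zero_iff_mem] at hp
  obtain ⟨Y, hY, q, hq, h⟩ := F.exists_mul_eq_phiPE_of_mem hp
  have hI : Y * p - q ∈ F.idealI := by
    rw [← ker_phiPE, RingHom.mem_ker, map_sub, map_mul, h, sub_self]
  have hYp : Y * p ∈ F.idealI ⊔ F.idealJ := by
    rw [← sub_add_cancel (Y * p) q]
    exact Ideal.add_mem _ (Ideal.mem_sup_left hI) (Ideal.mem_sup_right hq)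
  rw [← Ideal.Quotient.eq_zero_iff_mem, map_mul, (F.isUnit_mk_of_mem hY).mul_right_eq_zero] at hYp
  exact Ideal.Quotient.eq_zero_iff_mem.1 hYp

end UnimodularFan

end ToricFan

end

theorem theorem1p2 {N : Type*} [AddCommGroup N] [Module.Free ℤ N] [Module.Finite ℤ N]
    (F : ToricFan.UnimodularFan N) :
    Function.Surjective F.phi ∧
      RingHom.ker F.phi = F.idealI ⊔ F.idealJ ∧
      ∃ e : (MvPolynomial F.Ray ℤ ⧸ (F.idealI ⊔ F.idealJ)) ≃ₐ[ℤ] F.PEbar,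
        ∀ p : MvPolynomial F.Ray ℤ, e (Ideal.Quotient.mk _ p) = F.phi p :=
  ⟨F.phi_surjective, F.ker_phi,
    (Ideal.quotientEquivAlgOfEq ℤ F.ker_phi.symm).trans
      (Ideal.quotientKerAlgEquivOfSurjective F.phi_surjective),
    fun _ => rfl⟩
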